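/- Let $G$ be a finite group. For a finite $G$-set $X$, let $\mathbb R^X$ be the permutation representation, $g e_x=e_{gx}$. A \emph{layer space} in $\mathrm{Aff}_G(\mathbb R^Y,\mathbb R^X)$ is a set of maps $$M=\Big\{v\mapsto \sum_{i=1}^k x_i\varphi^i(v)+\sum_{j=1}^\ell y_j\mathbf 1_{X_j}\ :\ x_i,y_j\in\mathbb R\Big\},$$ where $\varphi^1,\dots,\varphi^k:\mathbb R^Y\to\mathbb R^X$ are $G$-equivariant linear maps and $X_1,\dots,X_\ell$ are all the $G$-orbits of $X$. For $k,h\in\mathbb N$ let $M^{k\times h}$ be the set of maps $(\mathbb R^Y)^k\to(\mathbb R^X)^h$, $(v_1,\dots,v_k)\mapsto\big(\sum_{i=1}^k f_{j,i}(v_i)\big)_{j=1,\dots,h}$ with all $f_{j,i}\in M$. Fix a continuous activation $\sigma:\mathbb R\to\mathbb R$ that is not a polynomial function, applied entry by entry. For composable layer spaces $M_1,\dots,M_n$, $M_i\subseteq\mathrm{Aff}_G(V_{i-1},V_i)$ with $V_0,\dots,V_n$ permutation representations on finite $G$-sets, let $$\mathcal U(M_1,\dots,M_n)=\overline{\bigcup_{h_1,\dots,h_{n-1}\in\mathbb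 N}\big\{\phi^n\circ\sigma\circ\phi^{n-1}\circ\cdots\circ\sigma\circ\phi^1\ :\ \phi^i\in M_i^{h_{i-1}\times h_i}\big\}},\qquad h_0=h_n=1,$$ the closure being taken in $C(V_0,V_n)$ for uniform convergence on compact sets. A class $\mathcal U$ of continuous maps $V\to\mathbb R^X$ is \emph{entry-wise separation-constrained universal} if it equals the set of all continuous $G$-equivariant maps $f:V\to\mathbb R^X$ such that, for every $x\in X$ and all $\alpha,\beta\in V$: if $u(\alpha)_x=u(\beta)_x$ for all $u\in\mathcal U$, then $f(\alpha)_x=f(\beta)_x$. \textbf{Statement.} Let $f\ge 1$, let $M_1,\dots,M_f$ be composable layer spaces as above with $V_f=\mathbb R^X$, and let $M$ be a layer space in $\mathrm{Aff}_G(\mathbb R^X,\mathbb R^X)$ containing the identity map. Then there is a natural number $D$ such that, for every $d\ge D$, the class $$\mathcal U(M_1,\dots,M_f,\underbrace{M,\dots,M}_{d\text{ times}})$$ is entry-wise separation-constrained universal. -/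

import Mathlib

universe u v

namespace EquivNet

/-- The permutation representation `ℝ^X` of a `G`-set `X`, with `ℝ^X` realised as `X → ℝ`:
`g` sends the basis vector `e_x` to `e_{g x}`, that is, `(g v)(x) = v (g⁻¹ x)`. -/
def permAct {G : Type v} [Group G] {X : Type u} [MulAction G X] (g : G) (a : X → ℝ) : X → ℝ :=
  fun x => a (g⁻¹ • x)

/-- `G`-equivariance of a map `ℝ^Y → ℝ^X` between permutation representations. -/
def IsEquivariant (G : Type v) [Group G] {Y X : Type u} [MulAction G Y] [MulAction G X]
    (f : (Y → ℝ) → (X → ℝ)) : Prop :=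
  ∀ (g : G) (a : Y → ℝ), f (permAct g a) = permAct g (f a)

/-- The vector `∑ⱼ yⱼ 𝟙_{Xⱼ}` of `ℝ^X`, where `Xⱼ` runs over all the `G`-orbits of `X`: its entry
at `x` is the coefficient of the orbit of `x`. -/
def orbitVector (G : Type v) [Group G] {X : Type u} [MulAction G X]
    (y : MulAction.orbitRel.Quotient G X → ℝ) : X → ℝ :=
  fun x => y (Quotient.mk (MulAction.orbitRel G X) x)

/-- A layer space in `Aff_G(ℝ^Y, ℝ^X)`: a set of affine maps of the form
`{ v ↦ ∑ᵢ xᵢ φⁱ(v) + ∑ⱼ yⱼ 𝟙_{Xⱼ} | xᵢ, yⱼ ∈ ℝ }` for some finite list `φ¹, …, φᵏ` of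
`G`-equivariant linear maps, `Xⱼ` running over all the orbits of `X`. -/
structure LayerSpace (G : Type v) [Group G] (Y X : Type u) [MulAction G Y] [MulAction G X] where
  /-- the affine maps that belong to the layer space -/
  carrier : Set ((Y → ℝ) →ᵃ[ℝ] (X → ℝ))
  exists_generators : ∃ (k : ℕ) (φ : Fin k → ((Y → ℝ) →ₗ[ℝ] (X → ℝ))),
    (∀ i, IsEquivariant G (φ i)) ∧
      carrier = {f | ∃ (x : Fin k → ℝ) (y : MulAction.orbitRel.Quotient G X → ℝ),
        ∀ a, f a = ∑ i, x i • φ i a + orbitVector G y}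

/-- The layer space with multiplicities `M^{k × h}`: the maps `ℝ^Y ⊗ ℝ^k → ℝ^X ⊗ ℝ^h` given by
an `h × k` matrix of elements of `M`. Elements of `ℝ^Y ⊗ ℝ^k` are `k`-tuples of vectors of `ℝ^Y`. -/
def LayerSpace.mult {G : Type v} [Group G] {Y X : Type u} [MulAction G Y] [MulAction G X]
    (M : LayerSpace G Y X) (k h : ℕ) : Set ((Fin k → Y → ℝ) → (Fin h → X → ℝ)) :=
  {F | ∃ f : Fin h → Fin k → ((Y → ℝ) →ᵃ[ℝ] (X → ℝ)),
    (∀ j i, f j i ∈ M.carrier) ∧ ∀ a j, F a j = ∑ i, f j i (a i)}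

/-- The point-wise activation `σ̃` on `ℝ^X ⊗ ℝ^k`. -/
def pointwise (σ : ℝ → ℝ) {X : Type u} {k : ℕ} (a : Fin k → X → ℝ) : Fin k → X → ℝ :=
  fun i x => σ (a i x)

/-- `LayerSeq G Y₀ X` is the type of composable sequences `M₁, …, Mₙ` (`n ≥ 1`) of layer spaces
`Mᵢ ⊆ Aff_G(ℝ^{Yᵢ₋₁}, ℝ^{Yᵢ})` with finite `G`-sets `Y₀, …, Yₙ` and `Yₙ = X`. -/
inductive LayerSeq (G : Type v) [Group G] (Y₀ : Type u) [Finite Y₀] [MulAction G Y₀] :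
    (X : Type u) → [Finite X] → [MulAction G X] → Type (max (u + 1) v)
  /-- the sequence with the single entry `M` -/
  | single {X : Type u} [Finite X] [MulAction G X] (M : LayerSpace G Y₀ X) : LayerSeq G Y₀ X
  /-- the sequence `A` followed by `M` -/
  | snoc {Y X : Type u} [Finite Y] [MulAction G Y] [Finite X] [MulAction G X]
      (A : LayerSeq G Y₀ Y) (M : LayerSpace G Y X) : LayerSeq G Y₀ X

namespace LayerSeq

variable {G : Type v} [Group G] {Y₀ : Type u} [Finite Y₀] [MulAction G Y₀]

/-- The number `n - 1` of hidden representations of the sequence `M₁, …, Mₙ`. -/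
def numHidden : {X : Type u} → [Finite X] → [MulAction G X] → LayerSeq G Y₀ X → ℕ
  | _, _, _, single _ => 0
  | _, _, _, snoc A _ => A.numHidden + 1

/-- The neural space `N(M₁^{1 × h₁}, M₂^{h₁ × h₂}, …, Mₙ^{hₙ₋₁ × h})` with activation `σ`, where
`w = (h₁, …, hₙ₋₁)`: all maps `φⁿ ∘ σ̃ ∘ ⋯ ∘ σ̃ ∘ φ¹` with `φⁱ` in the `i`-th layer space. -/
def neuralSpace (σ : ℝ → ℝ) : {X : Type u} → [Finite X] → [MulAction G X] →
    (A : LayerSeq G Y₀ X) → (w : Fin A.numHidden → ℕ) → (h : ℕ) →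
      Set ((Fin 1 → Y₀ → ℝ) → (Fin h → X → ℝ))
  | _, _, _, single M, _, h => M.mult 1 h
  | _, _, _, snoc A M, w, h =>
      {F | ∃ η ∈ neuralSpace σ A (Fin.init w) (w (Fin.last A.numHidden)),
        ∃ φ ∈ M.mult (w (Fin.last A.numHidden)) h, F = φ ∘ pointwise σ ∘ η}

/-- The universality class `U(M₁, …, Mₙ)`: the closure, in the topology of uniform convergence on
compact sets (the compact-open topology of `C(ℝ^{Y₀}, ℝ^X)`), of the union over all
`(h₁, …, hₙ₋₁)` of the neural spaces `N(M₁^{1 × h₁}, …, Mₙ^{hₙ₋₁ × 1})`. -/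
def univClass (σ : ℝ → ℝ) {X : Type u} [Finite X] [MulAction G X] (A : LayerSeq G Y₀ X) :
    Set C(Y₀ → ℝ, X → ℝ) :=
  closure (⋃ w : Fin A.numHidden → ℕ,
    {f | ∃ F ∈ A.neuralSpace σ w 1, ∀ a, f a = F (fun _ => a) 0})

/-- The sequence `M₁, …, Mₙ, M, …, M` with `d` copies of `M` appended. -/
def appendCopies {X : Type u} [Finite X] [MulAction G X] (A : LayerSeq G Y₀ X)
    (M : LayerSpace G X X) : ℕ → LayerSeq G Y₀ X
  | 0 => A
  | d + 1 => snoc (A.appendCopies M d) M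

end LayerSeq

/-- The separation relation `ρ_x` at the output entry `x` of a family `N` of maps `ℝ^Y → ℝ^X`. -/
def entrySep {Y X : Type u} (N : Set C(Y → ℝ, X → ℝ)) (x : X) : Set ((Y → ℝ) × (Y → ℝ)) :=
  {p | ∀ f ∈ N, f p.1 x = f p.2 x}

/-- The continuous `G`-equivariant maps `ℝ^Y → ℝ^X` that respect a family `ρ = (ρ_x)` of
relations entry by entry. -/
def entrywiseRespecting (G : Type v) [Group G] {Y X : Type u} [MulAction G Y] [MulAction G X]
    (ρ : X → Set ((Y → ℝ) × (Y → ℝ))) : Set C(Y → ℝ, X → ℝ) :=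
  {f | IsEquivariant G f ∧ ∀ x, ∀ p ∈ ρ x, f p.1 x = f p.2 x}

/-- A class `U` is entry-wise separation-constrained universal if it consists of exactly the
continuous equivariant maps that respect its own entry-wise separation relation. -/
def IsEntrywiseUniversal (G : Type v) [Group G] {Y X : Type u} [MulAction G Y] [MulAction G X]
    (U : Set C(Y → ℝ, X → ℝ)) : Prop :=
  U = entrywiseRespecting G (entrySep U)

end EquivNet

/-! Let `N d` be the linear space of networks with `d` copies of `M` appended; the universality
class is its closure. Two facts suffice.

One more layer reaches everything that the separation relation of `N d` allows. As `σ` is not a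
polynomial, the span of the ridge functions `σ (a * t + b)` is dense in `C(ℝ, ℝ)`, so `g ∘ η` with
`η ∈ N d` lies in the closure of `N (d + 1)` for every continuous `g`
(`layerComp_id_mem_closure_layerStep`). For `g = exp` these maps span an algebra, and
Stone–Weierstrass without separation of points applies (`mem_closure_layerStep_of_respecting`).

The separation relation stabilises. For a pair of inputs, the values of `N d` form a subspace of
`ℝ^X × ℝ^X` that grows with `d` and determines its successor, so it is constant from `d = 2|X|` on
(`Submodule.eq_succ_of_recurrence`). This bound does not depend on the pair. -/

open MeasureTheory Filter Topology

/-! ### Density criteria -/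

/-- A map lies in the closure of a set of maps for the compact-open topology as soon as it can be
approximated uniformly on every compact set. -/
theorem ContinuousMap.mem_closure_of_forall_isCompact {V E : Type*} [TopologicalSpace V]
    [PseudoMetricSpace E] {S : Set C(V, E)} {f : C(V, E)}
    (h : ∀ K : Set V, IsCompact K → ∀ ε > 0, ∃ g ∈ S, ∀ a ∈ K, dist (f a) (g a) < ε) :
    f ∈ closure S := by
  rw [mem_closure_iff_nhds_basis
    (nhds_basis_uniformity' Metric.uniformity_basis_dist.compactConvergenceUniformity)]
  rintro ⟨K, ε⟩ ⟨hK, hε⟩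
  obtain ⟨g, hg, hgK⟩ := h K hK ε hε
  exact ⟨g, hg, fun a ha => hgK a ha⟩

/-- A subspace of a normed space on which only the zero functional vanishes is dense. -/
theorem Submodule.mem_closure_of_forall_dual {E : Type*} [NormedAddCommGroup E] [NormedSpace ℝ E]
    (S : Submodule ℝ E) (h : ∀ L : E →L[ℝ] ℝ, (∀ s ∈ S, L s = 0) → L = 0) (x : E) :
    x ∈ closure (S : Set E) := by
  by_contra hx
  have hx' : x ∉ (S.topologicalClosure : Set E) := hx
  obtain ⟨L, u, hL, hu⟩ := geometric_hahn_banach_closed_point S.topologicalClosure.convex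
    S.isClosed_topologicalClosure hx'
  have h0 : 0 < u := by simpa using hL 0 S.topologicalClosure.zero_mem
  have hL0 : L = 0 := by
    refine h L fun s hs => ?_
    by_contra hne
    have := hL ((u / L s) • s)
      (S.topologicalClosure.smul_mem _ (S.le_topologicalClosure hs))
    simp [hne] at this
  simp [hL0] at hu
  linarith

/-! ### Density of ridge functions of one variable -/

namespace EquivNet

/-- The function `t ↦ t ^ k * τ (a * t + b)` on a set of real numbers. -/
def monomialRidge (K : Set ℝ) (k : ℕ) {τ : ℝ → ℝ} (hτ : Continuous τ) (a b : ℝ) : C(K, ℝ) :=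
  ⟨fun t => (t : ℝ) ^ k * τ (a * t + b), by fun_prop⟩

/-- The derivative is taken in the sup norm. The pointwise fundamental theorem of calculus shows
that the curve is a primitive of a continuous curve in `C(K, ℝ)`; the Banach-valued one then
differentiates it. -/
theorem hasDerivAt_monomialRidge {K : Set ℝ} [CompactSpace K] (k : ℕ) {τ : ℝ → ℝ}
    (hτ : ContDiff ℝ 1 τ) (a b : ℝ) :
    HasDerivAt (fun s => monomialRidge K k hτ.continuous s b)
      (monomialRidge K (k + 1) (hτ.continuous_deriv le_rfl) a b) a := by
  have hc : Continuous fun s => monomialRidge K (k + 1) (hτ.continuous_deriv le_rfl) s b := by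
    refine ContinuousMap.continuous_of_continuous_uncurry _ ?_
    have := hτ.continuous_deriv le_rfl
    simp only [Function.uncurry_def, monomialRidge, ContinuousMap.coe_mk]
    fun_prop
  have hF : (fun s => monomialRidge K k hτ.continuous s b) = fun s =>
      monomialRidge K k hτ.continuous a b +
        ∫ r in a..s, monomialRidge K (k + 1) (hτ.continuous_deriv le_rfl) r b := by
    funext s
    ext t
    have hev : (∫ r in a..s, monomialRidge K (k + 1) (hτ.continuous_deriv le_rfl) r b) t =
        ∫ r in a..s, monomialRidge K (k + 1) (hτ.continuous_deriv le_rfl) r b t :=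
      ((ContinuousMap.evalCLM ℝ t).intervalIntegral_comp_comm
        (hc.intervalIntegrable a s)).symm
    have hd : ∀ r ∈ Set.uIcc a s, HasDerivAt (fun r => (t : ℝ) ^ k * τ (r * t + b))
        (monomialRidge K (k + 1) (hτ.continuous_deriv le_rfl) r b t) r := by
      intro r _
      have h1 : HasDerivAt (fun r : ℝ => r * (t : ℝ) + b) (t : ℝ) r := by
        simpa using ((hasDerivAt_id r).mul_const (t : ℝ)).add_const b
      have h2 := ((hτ.differentiable one_ne_zero (r * t + b)).hasDerivAt.comp r h1).const_mul
        ((t : ℝ) ^ k)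
      refine h2.congr_deriv ?_
      simp only [monomialRidge, ContinuousMap.coe_mk]
      ring
    rw [ContinuousMap.add_apply, hev, intervalIntegral.integral_eq_sub_of_hasDerivAt hd
      ((((ContinuousMap.evalCLM ℝ t).continuous.comp hc)).intervalIntegrable a s)]
    simp [monomialRidge]
  rw [hF]
  exact (intervalIntegral.integral_hasDerivAt_right (hc.intervalIntegrable a a)
    hc.aestronglyMeasurable.stronglyMeasurableAtFilter hc.continuousAt).const_add _

/-- Differentiating the vanishing expression in `a` brings down a factor `t` and replaces `τ` by its
derivative. -/
theorem iteratedDeriv_monomialRidge_eq_zero {K : Set ℝ} [CompactSpace K] (L : C(K, ℝ) →L[ℝ] ℝ)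
    {τ : ℝ → ℝ} (hτ : ContDiff ℝ (⊤ : ℕ∞) τ)
    (hL : ∀ a b, L (monomialRidge K 0 hτ.continuous a b) = 0) (k : ℕ) (a b : ℝ) :
    L (monomialRidge K k (hτ.continuous_iteratedDeriv k (mod_cast le_top)) a b) = 0 := by
  induction k generalizing a b with
  | zero => simpa using hL a b
  | succ k ih =>
    have hk : ContDiff ℝ 1 (iteratedDeriv k τ) := by
      rw [iteratedDeriv_eq_iterate]
      exact ContDiff.iterate_deriv' 1 k (hτ.of_le (mod_cast le_top))
    have h1 := L.hasFDerivAt.comp_hasDerivAt a (hasDerivAt_monomialRidge (K := K) k hk a b)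
    have h2 : (L ∘ fun s => monomialRidge K k hk.continuous s b) = fun _ => 0 :=
      funext fun s => ih s b
    rw [h2] at h1
    have h3 := h1.unique (hasDerivAt_const a (0 : ℝ))
    simpa only [iteratedDeriv_succ] using h3

/-- A smooth function with vanishing `k`-th derivative is a polynomial of degree less than `k`. -/
theorem exists_coeff_of_iteratedDeriv_eq_zero (k : ℕ) {τ : ℝ → ℝ}
    (hτ : ContDiff ℝ (⊤ : ℕ∞) τ) (h : ∀ b, iteratedDeriv k τ b = 0) :
    ∃ c : ℕ → ℝ, ∀ t, τ t = ∑ i ∈ Finset.range k, c i * t ^ i := by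
  induction k generalizing τ with
  | zero => exact ⟨0, fun t => by simpa using h t⟩
  | succ k ih =>
    obtain ⟨c, hc⟩ := ih (contDiff_infty_iff_deriv.1 hτ).2 fun b => by
      rw [← iteratedDeriv_succ']
      exact h b
    have hq : ∀ t, HasDerivAt (fun t : ℝ => ∑ i ∈ Finset.range k, c i / (i + 1) * t ^ (i + 1))
        (deriv τ t) t := by
      intro t
      rw [hc]
      refine HasDerivAt.fun_sum fun i _ => ?_
      refine ((hasDerivAt_pow (i + 1) t).const_mul (c i / (i + 1))).congr_deriv ?_
      have : (i : ℝ) + 1 ≠ 0 := by positivity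
      push_cast
      field_simp
    have hd : Differentiable ℝ τ := hτ.differentiable (by simp)
    have hz := is_const_of_deriv_eq_zero
      (f := fun t => τ t - ∑ i ∈ Finset.range k, c i / (i + 1) * t ^ (i + 1))
      (fun t => ((hd t).hasDerivAt.sub (hq t)).differentiableAt)
      (fun t => (((hd t).hasDerivAt.sub (hq t)).deriv).trans (sub_self _))
    refine ⟨fun i => if i = 0 then τ 0 else c (i - 1) / i, fun t => ?_⟩
    have := hz t 0
    rw [Finset.sum_range_succ']
    simp at this ⊢
    linarith

/-- The functions that are given by polynomials of degree less than `k` are closed under pointwise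
limits. -/
theorem exists_polynomial_of_tendsto {k : ℕ} {s : ℕ → ℝ → ℝ} {σ : ℝ → ℝ}
    (hs : ∀ n, ∃ c : ℕ → ℝ, ∀ t, s n t = ∑ i ∈ Finset.range k, c i * t ^ i)
    (hlim : ∀ t, Tendsto (fun n => s n t) atTop (𝓝 (σ t))) :
    ∃ p : Polynomial ℝ, ∀ t, σ t = p.eval t := by
  -- Interpolation at the fixed nodes `0, …, k - 1`: each `s n` is determined by `k` values, and
  -- these converge.
  let v : ℕ → ℝ := fun i => i
  have hv : Set.InjOn v (Finset.range k) := fun i _ j _ hij => Nat.cast_injective hij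
  have key : ∀ n t, s n t = ∑ i ∈ Finset.range k, s n (v i) *
      (Lagrange.basis (Finset.range k) v i).eval t := by
    intro n t
    obtain ⟨c, hc⟩ := hs n
    let q : Polynomial ℝ := ∑ i ∈ Finset.range k, Polynomial.C (c i) * Polynomial.X ^ i
    have hq : ∀ t, s n t = q.eval t := fun t => by
      simp [q, hc, Polynomial.eval_finsetSum]
    have hdeg : q.degree < (Finset.range k).card := by
      rw [Finset.card_range]
      refine Polynomial.mem_degreeLT.1 (Submodule.sum_mem _ fun i hi => ?_)
      exact Polynomial.mem_degreeLT.2 ((Polynomial.degree_C_mul_X_pow_le i _).trans_lt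
        (by exact_mod_cast Finset.mem_range.1 hi))
    have := congrArg (Polynomial.eval t) (Lagrange.eq_interpolate hv hdeg)
    rw [hq, this, Lagrange.interpolate_apply, Polynomial.eval_finsetSum]
    simp [hq]
  refine ⟨∑ i ∈ Finset.range k, Polynomial.C (σ (v i)) * Lagrange.basis (Finset.range k) v i,
    fun t => tendsto_nhds_unique (hlim t) ?_⟩
  simp only [key _ t, Polynomial.eval_finsetSum, Polynomial.eval_mul, Polynomial.eval_C]
  exact tendsto_finsetSum _ fun i _ => (hlim (v i)).mul_const _

open scoped Convolution in
/-- A functional that vanishes on all ridge functions of `σ` vanishes on those of its smooth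
averages. -/
theorem map_monomialRidge_convolution_eq_zero {K : Set ℝ} [CompactSpace K] (L : C(K, ℝ) →L[ℝ] ℝ)
    {σ : ℝ → ℝ} (hσ : Continuous σ) (hL : ∀ a b, L (monomialRidge K 0 hσ a b) = 0) {φ : ℝ → ℝ}
    (hφ : Continuous φ) (hφc : HasCompactSupport φ)
    (hτ : Continuous (φ ⋆[ContinuousLinearMap.lsmul ℝ ℝ, volume] σ)) (a b : ℝ) :
    L (monomialRidge K 0 hτ a b) = 0 := by
  have hc : Continuous fun s => φ s • monomialRidge K 0 hσ a (b - s) := by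
    refine hφ.smul (ContinuousMap.continuous_of_continuous_uncurry _ ?_)
    simp only [Function.uncurry_def, monomialRidge, ContinuousMap.coe_mk]
    fun_prop
  have hint : Integrable (fun s => φ s • monomialRidge K 0 hσ a (b - s)) :=
    hc.integrable_of_hasCompactSupport hφc.smul_right
  -- The smoothed ridge function is a `C(K, ℝ)`-valued integral of ridge functions of `σ` with
  -- shifted bias, so `L` passes under the integral.
  have heq : monomialRidge K 0 hτ a b = ∫ s, φ s • monomialRidge K 0 hσ a (b - s) := by
    ext t
    have := (ContinuousMap.evalCLM ℝ t).integral_comp_comm hint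
    simp only [ContinuousMap.evalCLM_apply] at this
    rw [← this]
    simp [monomialRidge, convolution_def, add_sub_assoc]
  rw [heq, ← L.integral_comp_comm hint]
  simp [hL]

/-- A functional that vanishes on the ridge functions of a continuous function that is not a
polynomial vanishes on all monomials. -/
theorem map_pow_eq_zero_of_ridge {K : Set ℝ} [CompactSpace K] (L : C(K, ℝ) →L[ℝ] ℝ)
    {σ : ℝ → ℝ} (hσ : Continuous σ) (hσ_poly : ¬ ∃ p : Polynomial ℝ, ∀ t, σ t = p.eval t)
    (hL : ∀ a b, L (monomialRidge K 0 hσ a b) = 0) (k : ℕ) :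
    L (Polynomial.toContinuousMapOn (Polynomial.X ^ k) K) = 0 := by
  by_contra hne
  let φ : ℕ → ContDiffBump (0 : ℝ) := fun n =>
    ⟨1 / ((n : ℝ) + 1) / 2, 1 / ((n : ℝ) + 1), by positivity, half_lt_self (by positivity)⟩
  have hsm : ∀ n, ContDiff ℝ (⊤ : ℕ∞)
      (convolution ((φ n).normed volume) σ (ContinuousLinearMap.lsmul ℝ ℝ) volume) := fun n =>
    (φ n).hasCompactSupport_normed.contDiff_convolution_left _ (φ n).contDiff_normed
      hσ.locallyIntegrable
  -- If `L` does not kill `t ^ k`, every mollification of `σ` has vanishing `k`-th derivative. The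
  -- degree bound `k` is the same for all of them and so survives the limit.
  refine hσ_poly (exists_polynomial_of_tendsto (k := k) (fun n =>
    exists_coeff_of_iteratedDeriv_eq_zero k (hsm n) fun b => ?_) fun t =>
      ContDiffBump.convolution_tendsto_right_of_continuous (φ := φ)
        tendsto_one_div_add_atTop_nhds_zero_nat hσ t)
  -- At `a = 0` the ridge function is a scalar multiple of `t ^ k`.
  have h0 := iteratedDeriv_monomialRidge_eq_zero L (hsm n)
    (map_monomialRidge_convolution_eq_zero L hσ hL (φ n).continuous_normed
      (φ n).hasCompactSupport_normed (hsm n).continuous) k 0 b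
  have heq : ∀ τ : ℝ → ℝ, ∀ hτ : Continuous τ, monomialRidge K k hτ 0 b =
      τ b • Polynomial.toContinuousMapOn (Polynomial.X ^ k) K := by
    intro τ hτ
    ext t
    simp [monomialRidge, mul_comm]
  rw [heq, map_smul, smul_eq_mul] at h0
  exact (mul_eq_zero.1 h0).resolve_right hne

/-- The span of the functions `t ↦ σ (a * t + b)` is dense in the continuous functions of one
variable if `σ` is continuous and not a polynomial. -/
theorem mem_closure_span_ridge {σ : ℝ → ℝ} (hσ : Continuous σ)
    (hσ_poly : ¬ ∃ p : Polynomial ℝ, ∀ t, σ t = p.eval t) (g : C(ℝ, ℝ)) :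
    g ∈ closure (Submodule.span ℝ (Set.range fun p : ℝ × ℝ =>
      (⟨fun t => σ (p.1 * t + p.2), by fun_prop⟩ : C(ℝ, ℝ))) : Set C(ℝ, ℝ)) := by
  refine ContinuousMap.mem_closure_of_forall_isCompact fun K hK ε hε => ?_
  have : CompactSpace K := isCompact_iff_compactSpace.1 hK
  let S := Submodule.span ℝ (Set.range fun p : ℝ × ℝ =>
      (⟨fun t => σ (p.1 * t + p.2), by fun_prop⟩ : C(ℝ, ℝ)))
  let R : C(ℝ, ℝ) →ₗ[ℝ] C(K, ℝ) :=
    { toFun := fun f => f.restrict K, map_add' := fun _ _ => rfl, map_smul' := fun _ _ => rfl }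
  have hg := Submodule.mem_closure_of_forall_dual (S.map R) (fun L hL => ?_) (R g)
  · obtain ⟨_, ⟨s, hs, rfl⟩, hd⟩ := Metric.mem_closure_iff.1 hg ε hε
    exact ⟨s, hs, fun a ha => (ContinuousMap.dist_lt_iff hε).1 hd ⟨a, ha⟩⟩
  · have hm := map_pow_eq_zero_of_ridge L hσ hσ_poly fun a b => by
      convert hL _ (Submodule.mem_map_of_mem (Submodule.subset_span ⟨(a, b), rfl⟩))
      ext t
      change (t : ℝ) ^ 0 * σ (a * t + b) = σ (a * t + b)
      rw [pow_zero, one_mul]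
    have hp : ∀ p : Polynomial ℝ, L (p.toContinuousMapOn K) = 0 := by
      intro p
      have : L.toLinearMap ∘ₗ (Polynomial.toContinuousMapOnAlgHom K).toLinearMap = 0 := by
        refine Polynomial.lhom_ext' fun k => LinearMap.ext_ring ?_
        simpa [Polynomial.X_pow_eq_monomial] using hm k
      exact LinearMap.congr_fun this p
    ext f
    have hf : f ∈ (polynomialFunctions K).topologicalClosure := by
      rw [polynomialFunctions.topologicalClosure]
      trivial
    refine closure_minimal (t := {f | L f = 0}) ?_
      (isClosed_eq L.continuous continuous_const) hf
    rintro _ ⟨p, -, rfl⟩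
    exact hp p

end EquivNet

/-! ### Stone–Weierstrass for vector-valued maps -/

/-- A **Stone–Weierstrass theorem** without separation of points: a continuous map `f` into a finite
power of `ℝ` lies in the closure of a subalgebra `B` if any two entries that agree for all elements
of `B` agree for `f`. -/
theorem Subalgebra.mem_closure_of_forall_entry_eq {V X : Type*} [TopologicalSpace V] [Finite X]
    (B : Subalgebra ℝ C(V, X → ℝ)) (f : C(V, X → ℝ))
    (h : ∀ a x b y, (∀ u ∈ B, u a x = u b y) → f a x = f b y) :
    f ∈ closure (B : Set C(V, X → ℝ)) := by
  have := Fintype.ofFinite X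
  refine ContinuousMap.mem_closure_of_forall_isCompact fun K hK ε hε => ?_
  have : CompactSpace K := isCompact_iff_compactSpace.1 hK
  let _ : TopologicalSpace X := ⊥
  have : DiscreteTopology X := ⟨rfl⟩
  have hcont : ∀ u : C(V, X → ℝ), Continuous fun p : K × X => u p.1 p.2 := fun u =>
    continuous_prod_of_discrete_right.2 fun x =>
      (continuous_apply x).comp (u.continuous.comp continuous_subtype_val)
  -- Entries count as points: `K × X` is compact, and `e` identifies exactly the points that `B`
  -- cannot separate. On its compact image `B` separates points, and `f` descends to it.
  let e : K × X → B → ℝ := fun p u => u.1 p.1 p.2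
  have he : Continuous e := continuous_pi fun u => hcont u.1
  have : CompactSpace (Set.range e) := isCompact_iff_compactSpace.1 (isCompact_range he)
  have hq : Topology.IsQuotientMap (Set.rangeFactorization e) :=
    (he.subtype_mk _).isClosedMap.isQuotientMap (he.subtype_mk _)
      Set.rangeFactorization_surjective
  let q : C(K × X, Set.range e) := ⟨Set.rangeFactorization e, hq.continuous⟩
  have hfac : Function.FactorsThrough (⟨_, hcont f⟩ : C(K × X, ℝ)) q := fun p p' hpp =>
    h _ _ _ _ fun u hu => congrFun (congrArg Subtype.val hpp) ⟨u, hu⟩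
  let F : C(Set.range e, ℝ) := Topology.IsQuotientMap.lift (f := q) hq ⟨_, hcont f⟩ hfac
  have hF : ∀ p, F (q p) = f p.1 p.2 := fun p =>
    DFunLike.congr_fun (Topology.IsQuotientMap.lift_comp (f := q) hq ⟨_, hcont f⟩ hfac) p
  let T : B →ₐ[ℝ] C(Set.range e, ℝ) :=
    { toFun := fun u => ⟨fun z => z.1 u, (continuous_apply u).comp continuous_subtype_val⟩
      map_one' := by ext ⟨_, p, rfl⟩; rfl
      map_mul' := fun u v => by ext ⟨_, p, rfl⟩; rfl
      map_zero' := by ext ⟨_, p, rfl⟩; rfl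
      map_add' := fun u v => by ext ⟨_, p, rfl⟩; rfl
      commutes' := fun r => by ext ⟨_, p, rfl⟩; rfl }
  have hsep : T.range.SeparatesPoints := by
    intro z z' hz
    obtain ⟨u, hu⟩ := Function.ne_iff.1 fun hzz => hz (Subtype.ext hzz)
    exact ⟨T u, ⟨T u, ⟨u, rfl⟩, rfl⟩, hu⟩
  obtain ⟨⟨_, u, rfl⟩, hu⟩ :=
    ContinuousMap.exists_mem_subalgebra_near_continuousMap_of_separatesPoints T.range hsep F ε hε
  refine ⟨u.1, u.2, fun a ha => (dist_pi_lt_iff hε).2 fun x => ?_⟩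
  have := (ContinuousMap.norm_lt_iff _ hε).1 hu (q (⟨a, ha⟩, x))
  rw [ContinuousMap.sub_apply, hF, norm_sub_rev] at this
  exact this

/-! ### Layer spaces, and networks of arbitrary width as a linear space -/

namespace EquivNet

section LayerSpace

variable {G : Type v} [Group G] {Y X : Type u} [MulAction G Y] [MulAction G X]

theorem orbitVector_add (y z : MulAction.orbitRel.Quotient G X → ℝ) :
    orbitVector G (y + z) = orbitVector G y + orbitVector G z :=
  rfl

theorem orbitVector_smul (c : ℝ) (y : MulAction.orbitRel.Quotient G X → ℝ) :
    orbitVector G (c • y) = c • orbitVector G y :=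
  rfl

theorem permAct_orbitVector (g : G) (y : MulAction.orbitRel.Quotient G X → ℝ) :
    permAct g (orbitVector G y) = orbitVector G y := by
  funext x
  exact congrArg y (Quotient.sound ⟨g⁻¹, rfl⟩)

theorem LayerSpace.add_mem (M : LayerSpace G Y X) {m m' : (Y → ℝ) →ᵃ[ℝ] (X → ℝ)}
    (hm : m ∈ M.carrier) (hm' : m' ∈ M.carrier) : m + m' ∈ M.carrier := by
  obtain ⟨k, φ, -, hM⟩ := M.exists_generators
  rw [hM] at hm hm' ⊢
  obtain ⟨x, y, h⟩ := hm
  obtain ⟨x', y', h'⟩ := hm'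
  refine ⟨x + x', y + y', fun a => ?_⟩
  simp only [AffineMap.coe_add, Pi.add_apply, h, h', add_smul, Finset.sum_add_distrib,
    orbitVector_add]
  abel

theorem LayerSpace.smul_mem (M : LayerSpace G Y X) (c : ℝ) {m : (Y → ℝ) →ᵃ[ℝ] (X → ℝ)}
    (hm : m ∈ M.carrier) : c • m ∈ M.carrier := by
  obtain ⟨k, φ, -, hM⟩ := M.exists_generators
  rw [hM] at hm ⊢
  obtain ⟨x, y, h⟩ := hm
  refine ⟨c • x, c • y, fun a => ?_⟩
  simp [h, Finset.smul_sum, mul_smul, orbitVector_smul]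

theorem LayerSpace.const_mem (M : LayerSpace G Y X) (y : MulAction.orbitRel.Quotient G X → ℝ) :
    AffineMap.const ℝ (Y → ℝ) (orbitVector G y) ∈ M.carrier := by
  obtain ⟨k, φ, -, hM⟩ := M.exists_generators
  rw [hM]
  exact ⟨0, y, fun a => by simp⟩

theorem LayerSpace.zero_mem (M : LayerSpace G Y X) : 0 ∈ M.carrier :=
  M.const_mem 0

theorem LayerSpace.isEquivariant (M : LayerSpace G Y X) {m : (Y → ℝ) →ᵃ[ℝ] (X → ℝ)}
    (hm : m ∈ M.carrier) : IsEquivariant G m := by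
  obtain ⟨k, φ, hφ, hM⟩ := M.exists_generators
  rw [hM] at hm
  obtain ⟨x, y, h⟩ := hm
  intro g a
  rw [h, h]
  simp only [hφ _ g a]
  funext z
  have := congrFun (permAct_orbitVector g y) z
  simp only [permAct, Pi.add_apply, Finset.sum_apply, Pi.smul_apply] at this ⊢
  rw [this]

end LayerSpace

theorem continuous_affineMap {Y X : Type*} [Finite Y] [Finite X]
    (m : (Y → ℝ) →ᵃ[ℝ] (X → ℝ)) : Continuous m := by
  have := Fintype.ofFinite Y
  have := Fintype.ofFinite X
  exact m.continuous_of_finiteDimensional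

section Step

variable {G : Type v} [Group G] {V : Type*} [TopologicalSpace V] {Y X : Type u}
  [MulAction G Y] [MulAction G X]

/-- The span of the maps `m ∘ σ ∘ η` with `m` in a layer space and `η` in a given space of maps. -/
def layerStep (σ : ℝ → ℝ) (M : LayerSpace G Y X) (N : Submodule ℝ C(V, Y → ℝ)) :
    Submodule ℝ C(V, X → ℝ) :=
  Submodule.span ℝ {f | ∃ m ∈ M.carrier, ∃ η ∈ N, ∀ a, f a = m fun y => σ (η a y)}

/-- The map `m ∘ g ∘ η`, where `g` is applied entry by entry. -/
def layerComp [Finite Y] [Finite X] (m : (Y → ℝ) →ᵃ[ℝ] (X → ℝ)) (g : C(ℝ, ℝ)) (η : C(V, Y → ℝ)) :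
    C(V, X → ℝ) :=
  ⟨fun a => m fun y => g (η a y),
    (continuous_affineMap m).comp (continuous_pi fun y =>
      g.continuous.comp ((continuous_apply y).comp η.continuous))⟩

theorem exists_sum_of_mem_layerStep {σ : ℝ → ℝ} {M : LayerSpace G Y X}
    {N : Submodule ℝ C(V, Y → ℝ)} {f : C(V, X → ℝ)} (hf : f ∈ layerStep σ M N) :
    ∃ (n : ℕ) (m : Fin n → ((Y → ℝ) →ᵃ[ℝ] (X → ℝ))) (η : Fin n → C(V, Y → ℝ)),
      (∀ i, m i ∈ M.carrier) ∧ (∀ i, η i ∈ N) ∧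
        ∀ a, f a = ∑ i, m i fun y => σ (η i a y) := by
  obtain ⟨n, c, s, rfl⟩ := Submodule.mem_span_set'.1 hf
  choose m hm η hη hs using fun i => (s i).2
  refine ⟨n, fun i => c i • m i, η, fun i => M.smul_mem _ (hm i), hη, fun a => ?_⟩
  simp [hs]

end Step

namespace LayerSeq

variable {G : Type v} [Group G] {Y₀ : Type u} [Finite Y₀] [MulAction G Y₀]

/-- The space of all maps `φⁿ ∘ σ ∘ ⋯ ∘ σ ∘ φ¹` with arbitrary multiplicities. -/
def netSpace (σ : ℝ → ℝ) : {X : Type u} → [Finite X] → [MulAction G X] →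
    LayerSeq G Y₀ X → Submodule ℝ C(Y₀ → ℝ, X → ℝ)
  | _, _, _, single M => Submodule.span ℝ {f | ∃ m ∈ M.carrier, ∀ a, f a = m a}
  | _, _, _, snoc A M => layerStep σ M (netSpace σ A)

theorem exists_mem_netSpace {σ : ℝ → ℝ} (hσ : Continuous σ) {X : Type u} [Finite X]
    [MulAction G X] (A : LayerSeq G Y₀ X) (w : Fin A.numHidden → ℕ) (h : ℕ)
    {F : (Fin 1 → Y₀ → ℝ) → (Fin h → X → ℝ)} (hF : F ∈ A.neuralSpace σ w h) (j : Fin h) :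
    ∃ f ∈ A.netSpace σ, ∀ a, f a = F (fun _ => a) j := by
  induction A generalizing h with
  | single M =>
    obtain ⟨m, hm, hF⟩ := hF
    exact ⟨⟨m j 0, continuous_affineMap (m j 0)⟩,
      Submodule.subset_span ⟨m j 0, hm j 0, fun _ => rfl⟩, fun a => by simp [hF]⟩
  | snoc A M ih =>
    obtain ⟨η, hη, φ, ⟨m, hm, hφ⟩, rfl⟩ := hF
    choose ξ hξ hξη using ih _ _ hη
    refine ⟨∑ i, layerComp (m j i) ⟨σ, hσ⟩ (ξ i), Submodule.sum_mem _ fun i _ =>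
      Submodule.subset_span ⟨m j i, hm j i, ξ i, hξ i, fun _ => rfl⟩, fun a => ?_⟩
    simp only [Function.comp_apply, hφ, ContinuousMap.coe_sum, Finset.sum_apply]
    refine Finset.sum_congr rfl fun i _ => congrArg (m j i) ?_
    funext y
    simp [hξη, pointwise]

/-- Every `f j` is a sum of its own terms `m ∘ σ ∘ η`; the inner maps of all `j` are put side by
side as hidden channels. Hence the induction needs arbitrary output multiplicity `h`. -/
theorem exists_mem_neuralSpace {σ : ℝ → ℝ} {X : Type u} [Finite X]
    [MulAction G X] (A : LayerSeq G Y₀ X) (h : ℕ) (f : Fin h → C(Y₀ → ℝ, X → ℝ))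
    (hf : ∀ j, f j ∈ A.netSpace σ) :
    ∃ w, ∃ F ∈ A.neuralSpace σ w h, ∀ a j, f j a = F (fun _ => a) j := by
  induction A generalizing h with
  | single M =>
    have : ∀ j, ∃ m ∈ M.carrier, ∀ a, f j a = m a := by
      intro j
      refine Submodule.span_induction (fun _ h => h) ⟨0, M.zero_mem, fun a => rfl⟩ ?_ ?_ (hf j)
      · rintro _ _ - - ⟨m, hm, h⟩ ⟨m', hm', h'⟩
        exact ⟨m + m', M.add_mem hm hm', fun a => by simp [h, h']⟩
      · rintro c _ - ⟨m, hm, h⟩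
        exact ⟨c • m, M.smul_mem c hm, fun a => by simp [h]⟩
    choose m hm hfm using this
    exact ⟨Fin.elim0, fun a j => m j (a 0), ⟨fun j _ => m j, fun j _ => hm j, by simp⟩,
      fun a j => hfm j a⟩
  | snoc A M ih =>
    choose n m η hm hη hfm using fun j => exists_sum_of_mem_layerStep (hf j)
    obtain ⟨H, ⟨e⟩⟩ : ∃ H, Nonempty (Fin H ≃ Σ j, Fin (n j)) :=
      ⟨_, ⟨(Fintype.equivFin (Σ j, Fin (n j))).symm⟩⟩
    obtain ⟨w, F, hF, hFη⟩ := ih _ (fun i => η (e i).1 (e i).2) fun i => hη _ _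
    obtain ⟨w', rfl, rfl⟩ : ∃ w' : Fin (A.numHidden + 1) → ℕ, Fin.init w' = w ∧
        w' (Fin.last _) = H :=
      ⟨Fin.snoc (α := fun _ => ℕ) w _, Fin.init_snoc _ _, Fin.snoc_last _ _⟩
    -- Block matrix: output `j` reads only the channels that belong to `j`.
    refine ⟨w', _, ⟨F, hF, fun b j => ∑ i, (if (e i).1 = j then m (e i).1 (e i).2 else 0) (b i),
      ⟨fun j i => if (e i).1 = j then m (e i).1 (e i).2 else 0, fun j i => ?_, fun _ _ => rfl⟩,
      rfl⟩, fun a j => ?_⟩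
    · dsimp only
      split_ifs
      exacts [hm _ _, M.zero_mem]
    · rw [hfm]
      simp only [Function.comp_apply]
      have hp : ∀ i, pointwise σ (F fun _ => a) i = fun y => σ (η (e i).1 (e i).2 a y) := by
        intro i
        funext y
        simp [pointwise, ← hFη]
      simp only [hp]
      rw [e.sum_comp (fun p => (if p.1 = j then m p.1 p.2 else 0) fun y => σ (η p.1 p.2 a y)),
        Fintype.sum_sigma, Finset.sum_eq_single j]
      · simp
      · intro k _ hk
        simp [hk]
      · simp

theorem univClass_eq_closure_netSpace {σ : ℝ → ℝ} (hσ : Continuous σ) {X : Type u} [Finite X]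
    [MulAction G X] (A : LayerSeq G Y₀ X) :
    A.univClass σ = closure (A.netSpace σ : Set C(Y₀ → ℝ, X → ℝ)) := by
  refine congrArg closure (Set.ext fun f => ⟨fun hf => ?_, fun hf => ?_⟩)
  · obtain ⟨w, F, hF, hf⟩ := Set.mem_iUnion.1 hf
    obtain ⟨f', hf', h⟩ := A.exists_mem_netSpace hσ w 1 hF 0
    obtain rfl : f = f' := ContinuousMap.ext fun a => (hf a).trans (h a).symm
    exact hf'
  · obtain ⟨w, F, hF, h⟩ := A.exists_mem_neuralSpace 1 (fun _ => f) fun _ => hf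
    exact Set.mem_iUnion.2 ⟨w, F, hF, fun a => h a 0⟩

theorem isEquivariant_of_mem_netSpace {σ : ℝ → ℝ} {X : Type u} [Finite X]
    [MulAction G X] (A : LayerSeq G Y₀ X) {f : C(Y₀ → ℝ, X → ℝ)} (hf : f ∈ A.netSpace σ) :
    IsEquivariant G f := by
  induction A with
  | single M =>
    refine Submodule.span_induction ?_ (fun _ _ => rfl) ?_ ?_ hf
    · rintro f ⟨m, hm, h⟩ g a
      rw [h, h, M.isEquivariant hm]
    · intro f f' _ _ h h' g a
      rw [ContinuousMap.add_apply, ContinuousMap.add_apply, h, h']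
      rfl
    · intro c f _ h g a
      rw [ContinuousMap.smul_apply, ContinuousMap.smul_apply, h]
      rfl
  | snoc A M ih =>
    refine Submodule.span_induction ?_ (fun _ _ => rfl) ?_ ?_ hf
    · rintro f ⟨m, hm, η, hη, h⟩ g a
      rw [h, h, ← M.isEquivariant hm, ih hη]
      rfl
    · intro f f' _ _ h h' g a
      rw [ContinuousMap.add_apply, ContinuousMap.add_apply, h, h']
      rfl
    · intro c f _ h g a
      rw [ContinuousMap.smul_apply, ContinuousMap.smul_apply, h]
      rfl

/-- The biases of the last layer give these constants. They serve twice: as the shift `b` in ridge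
functions, and to separate entries in different orbits. -/
theorem const_orbitVector_mem_netSpace {σ : ℝ → ℝ} {X : Type u} [Finite X]
    [MulAction G X] (A : LayerSeq G Y₀ X) (y : MulAction.orbitRel.Quotient G X → ℝ) :
    ContinuousMap.const _ (orbitVector G y) ∈ A.netSpace σ := by
  cases A with
  | single M => exact Submodule.subset_span ⟨_, M.const_mem y, fun _ => rfl⟩
  | snoc A M => exact Submodule.subset_span ⟨_, M.const_mem y, 0, zero_mem _, fun _ => rfl⟩

end LayerSeq

end EquivNet

/-! ### Effect of an additional layer, and stabilisation at two points -/

/-- An increasing sequence of subspaces of a finite-dimensional space in which every term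
determines the next one is constant from the dimension of the space on. -/
theorem Submodule.eq_succ_of_recurrence {E : Type*} [AddCommGroup E] [Module ℝ E]
    [FiniteDimensional ℝ E] {W : ℕ → Submodule ℝ E} (hmono : ∀ d, W d ≤ W (d + 1))
    {Φ : Submodule ℝ E → Submodule ℝ E} (hΦ : ∀ d, W (d + 1) = Φ (W d)) {d : ℕ}
    (hd : Module.finrank ℝ E ≤ d) : W d = W (d + 1) := by
  -- Strict growth at every step up to the dimension would exceed it.
  obtain ⟨k, hk, hkk⟩ : ∃ k ≤ Module.finrank ℝ E, W k = W (k + 1) := by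
    by_contra! hne
    have hrank : ∀ k ≤ Module.finrank ℝ E + 1, k ≤ Module.finrank ℝ (W k) := by
      intro k
      induction k with
      | zero => simp
      | succ k ih =>
        intro hk
        have := Submodule.finrank_lt_finrank_of_lt
          ((hmono k).lt_of_ne (hne k (Nat.le_of_succ_le_succ hk)))
        have := ih (by omega)
        omega
    have := hrank _ le_rfl
    have := Submodule.finrank_le (W (Module.finrank ℝ E + 1))
    omega
  exact Nat.le_induction hkk (fun n _ hn => (hΦ n).trans ((congrArg Φ hn).trans (hΦ _).symm)) d
    (hk.trans hd)

namespace EquivNet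

section Step

variable {G : Type v} [Group G] {V : Type*} [TopologicalSpace V] {X : Type u} [Finite X]
  [MulAction G X] {M : LayerSpace G X X} {σ : ℝ → ℝ}

/-- Post-composition of a network with a continuous function of one variable can be approximated
with one additional layer. -/
theorem layerComp_id_mem_closure_layerStep (hσ : Continuous σ)
    (hσ_poly : ¬ ∃ p : Polynomial ℝ, ∀ t, σ t = p.eval t)
    (hM : AffineMap.id ℝ (X → ℝ) ∈ M.carrier) {N : Submodule ℝ C(V, X → ℝ)}
    (hN : ContinuousMap.const V (1 : X → ℝ) ∈ N) (g : C(ℝ, ℝ)) {η : C(V, X → ℝ)} (hη : η ∈ N) :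
    layerComp (AffineMap.id ℝ (X → ℝ)) g η ∈ closure (layerStep σ M N : Set C(V, X → ℝ)) := by
  let T : C(ℝ, ℝ) →ₗ[ℝ] C(V, X → ℝ) :=
    { toFun := fun g => layerComp (AffineMap.id ℝ (X → ℝ)) g η
      map_add' := fun _ _ => rfl
      map_smul' := fun _ _ => rfl }
  have hT : Continuous T := by
    refine ContinuousMap.continuous_of_continuous_uncurry _ (continuous_pi fun y => ?_)
    change Continuous fun p : C(ℝ, ℝ) × V => p.1 (η p.2 y)
    exact continuous_fst.eval (((continuous_apply y).comp η.continuous).comp continuous_snd)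
  refine map_mem_closure (f := T) hT (mem_closure_span_ridge hσ hσ_poly g) fun s hs => ?_
  refine (Submodule.span_le (p := (layerStep σ M N).comap T)).2 ?_ hs
  rintro _ ⟨⟨a, b⟩, rfl⟩
  refine Submodule.subset_span ⟨_, hM, a • η + b • ContinuousMap.const V (1 : X → ℝ),
    N.add_mem (N.smul_mem _ hη) (N.smul_mem _ hN), fun v => ?_⟩
  funext y
  simp [T, layerComp]

theorem le_closure_layerStep (hσ : Continuous σ)
    (hσ_poly : ¬ ∃ p : Polynomial ℝ, ∀ t, σ t = p.eval t)
    (hM : AffineMap.id ℝ (X → ℝ) ∈ M.carrier) {N : Submodule ℝ C(V, X → ℝ)}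
    (hN : ContinuousMap.const V (1 : X → ℝ) ∈ N) :
    N ≤ (layerStep σ M N).topologicalClosure :=
  fun _ hη => layerComp_id_mem_closure_layerStep hσ hσ_poly hM hN (ContinuousMap.id ℝ) hη

/-- Evaluation at two points. -/
def evalPair (p : V × V) : C(V, X → ℝ) →L[ℝ] (X → ℝ) × (X → ℝ) :=
  (ContinuousMap.evalCLM ℝ p.1).prod (ContinuousMap.evalCLM ℝ p.2)

/-- The effect of an additional layer on the values at two points. -/
def pairStep (σ : ℝ → ℝ) (M : LayerSpace G X X) (W : Submodule ℝ ((X → ℝ) × (X → ℝ))) :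
    Submodule ℝ ((X → ℝ) × (X → ℝ)) :=
  Submodule.span ℝ {z | ∃ m ∈ M.carrier, ∃ w ∈ W,
    z = (m fun y => σ (w.1 y), m fun y => σ (w.2 y))}

/-- A layer acts on the values at each input separately, so the new values depend on `N` only
through the old ones. This is the recurrence that forces stabilisation. -/
theorem map_evalPair_layerStep (hσ : Continuous σ) (N : Submodule ℝ C(V, X → ℝ)) (p : V × V) :
    (layerStep σ M N).map (evalPair p).toLinearMap =
      pairStep σ M (N.map (evalPair p).toLinearMap) := by
  rw [layerStep, Submodule.map_span, pairStep]
  congr 1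
  ext z
  constructor
  · rintro ⟨f, ⟨m, hm, η, hη, hf⟩, rfl⟩
    exact ⟨m, hm, _, ⟨η, hη, rfl⟩, Prod.ext (hf p.1) (hf p.2)⟩
  · rintro ⟨m, hm, _, ⟨η, hη, rfl⟩, rfl⟩
    exact ⟨layerComp m ⟨σ, hσ⟩ η, ⟨m, hm, η, hη, fun _ => rfl⟩, rfl⟩

/-- `N` lies only in the closure of the next space, but subspaces of a finite-dimensional space are
closed, so after evaluation the inclusion is exact. -/
theorem map_evalPair_le (hσ : Continuous σ)
    (hσ_poly : ¬ ∃ p : Polynomial ℝ, ∀ t, σ t = p.eval t)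
    (hM : AffineMap.id ℝ (X → ℝ) ∈ M.carrier) {N : Submodule ℝ C(V, X → ℝ)}
    (hN : ContinuousMap.const V (1 : X → ℝ) ∈ N) (p : V × V) :
    N.map (evalPair p).toLinearMap ≤ (layerStep σ M N).map (evalPair p).toLinearMap := by
  rintro _ ⟨η, hη, rfl⟩
  have h := map_mem_closure (evalPair p).continuous (le_closure_layerStep hσ hσ_poly hM hN hη)
    fun f hf => Submodule.mem_map_of_mem (f := (evalPair p).toLinearMap) hf
  have : FiniteDimensional ℝ ((layerStep σ M N).map (evalPair p).toLinearMap) :=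
    FiniteDimensional.finiteDimensional_submodule _
  exact (Submodule.closed_of_finiteDimensional _).closure_subset h

end Step

/-! ### Separation relations -/

section Separation

variable {Y X : Type u}

theorem entrySep_closure (S : Set C(Y → ℝ, X → ℝ)) (x : X) :
    entrySep (closure S) x = entrySep S x := by
  refine Set.Subset.antisymm (fun p hp f hf => hp f (subset_closure hf)) fun p hp f hf => ?_
  refine closure_minimal (t := {f : C(Y → ℝ, X → ℝ) | f p.1 x = f p.2 x}) hp ?_ hf
  exact isClosed_eq ((continuous_apply x).comp (continuous_eval_const p.1))
    ((continuous_apply x).comp (continuous_eval_const p.2))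

theorem mem_entrySep_iff_map_evalPair (N : Submodule ℝ C(Y → ℝ, X → ℝ)) (x : X)
    (p : (Y → ℝ) × (Y → ℝ)) :
    p ∈ entrySep (N : Set C(Y → ℝ, X → ℝ)) x ↔
      ∀ w ∈ N.map (evalPair p).toLinearMap, w.1 x = w.2 x :=
  ⟨by rintro hp _ ⟨f, hf, rfl⟩; exact hp f hf, fun h f hf => h _ ⟨f, hf, rfl⟩⟩

theorem isClosed_setOf_isEquivariant (G : Type v) [Group G] [MulAction G Y] [MulAction G X] :
    IsClosed {f : C(Y → ℝ, X → ℝ) | IsEquivariant G f} := by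
  simp only [IsEquivariant, Set.ofPred_forall]
  refine isClosed_iInter fun g => isClosed_iInter fun a =>
    isClosed_eq (continuous_eval_const _) (continuous_pi fun x => ?_)
  exact (continuous_apply (g⁻¹ • x)).comp (continuous_eval_const a)

end Separation

/-! ### Approximation of all maps that respect the separation relation -/

namespace LayerSeq

variable {G : Type v} [Group G] {Y₀ : Type u} [Finite Y₀] [MulAction G Y₀]
  {X : Type u} [Finite X] [MulAction G X] {σ : ℝ → ℝ}

/-- If all entries that are not separated by the networks `A` agree for the equivariant map `f`,
then `f` can be approximated with one additional layer. -/
theorem mem_closure_layerStep_of_respecting (hσ : Continuous σ)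
    (hσ_poly : ¬ ∃ p : Polynomial ℝ, ∀ t, σ t = p.eval t) (A : LayerSeq G Y₀ X)
    {M : LayerSpace G X X} (hM : AffineMap.id ℝ (X → ℝ) ∈ M.carrier) {f : C(Y₀ → ℝ, X → ℝ)}
    (hf : f ∈ entrywiseRespecting G (entrySep (A.netSpace σ : Set C(Y₀ → ℝ, X → ℝ)))) :
    f ∈ closure (layerStep σ M (A.netSpace σ) : Set C(Y₀ → ℝ, X → ℝ)) := by
  let ex : C(Y₀ → ℝ, X → ℝ) → C(Y₀ → ℝ, X → ℝ) := fun η =>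
    layerComp (AffineMap.id ℝ (X → ℝ)) ⟨Real.exp, Real.continuous_exp⟩ η
  have hex : ∀ η a x, ex η a x = Real.exp (η a x) := fun _ _ _ => rfl
  -- `exp` turns sums into products, so the exponentials of a linear space form a monoid and their
  -- span is already an algebra.
  let E : Submonoid C(Y₀ → ℝ, X → ℝ) :=
    { carrier := ex '' (A.netSpace σ : Set C(Y₀ → ℝ, X → ℝ))
      one_mem' := ⟨0, zero_mem _, by ext a x; simp [hex]⟩
      mul_mem' := by
        rintro _ _ ⟨η, hη, rfl⟩ ⟨ξ, hξ, rfl⟩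
        exact ⟨η + ξ, add_mem hη hξ, by ext a x; simp [hex, Real.exp_add]⟩ }
  have hB : (Algebra.adjoin ℝ (E : Set C(Y₀ → ℝ, X → ℝ)) : Set C(Y₀ → ℝ, X → ℝ)) ⊆
      closure (layerStep σ M (A.netSpace σ) : Set C(Y₀ → ℝ, X → ℝ)) := by
    intro u hu
    have hu' : u ∈ Submodule.span ℝ (E : Set C(Y₀ → ℝ, X → ℝ)) := by
      rw [SetLike.mem_coe, ← Subalgebra.mem_toSubmodule, Algebra.adjoin_eq_span,
        Submonoid.closure_eq] at hu
      exact hu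
    refine (Submodule.span_le (p := (layerStep σ M (A.netSpace σ)).topologicalClosure)).2 ?_ hu'
    rintro _ ⟨η, hη, rfl⟩
    exact layerComp_id_mem_closure_layerStep hσ hσ_poly hM
      (A.const_orbitVector_mem_netSpace 1) _ hη
  refine closure_minimal hB isClosed_closure
    (Subalgebra.mem_closure_of_forall_entry_eq _ f fun a x b y h => ?_)
  have hN : ∀ η ∈ A.netSpace σ, η a x = η b y := fun η hη =>
    Real.exp_injective (h _ (Algebra.subset_adjoin ⟨η, hη, rfl⟩))
  -- The indicator of the orbit of `y` is a constant network, so unseparated entries share an orbit.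
  obtain ⟨g, rfl⟩ : ∃ g : G, g • x = y := by
    classical
    have := hN _ (A.const_orbitVector_mem_netSpace
      (Pi.single (Quotient.mk (MulAction.orbitRel G X) y) 1))
    by_contra hne
    have hxy : (Quotient.mk (MulAction.orbitRel G X) x) ≠ Quotient.mk _ y := fun hxy => by
      obtain ⟨g, hg⟩ := Quotient.exact hxy.symm
      exact hne ⟨g, hg⟩
    simp [orbitVector, hxy] at this
  have hact : ∀ c : X → ℝ, permAct g⁻¹ c x = c (g • x) := fun c => by simp [permAct]
  -- By equivariance, entry `g • x` at `b` is entry `x` at `g⁻¹ b`, which leaves a comparison at the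
  -- single entry `x`.
  rw [← hact (f b), ← hf.1]
  refine hf.2 x (a, permAct g⁻¹ b) fun η hη => ?_
  rw [A.isEquivariant_of_mem_netSpace hη, hact]
  exact hN η hη

end LayerSeq

end EquivNet

theorem mainTheorem4 {G : Type v} [Group G] [Finite G]
    {Y₀ X : Type u} [Finite Y₀] [MulAction G Y₀] [Finite X] [MulAction G X]
    (σ : ℝ → ℝ) (hσ : Continuous σ) (hσ_poly : ¬ ∃ p : Polynomial ℝ, ∀ t, σ t = p.eval t)
    (A : EquivNet.LayerSeq G Y₀ X)
    (M : EquivNet.LayerSpace G X X) (hM : AffineMap.id ℝ (X → ℝ) ∈ M.carrier) :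
    ∃ D : ℕ, ∀ d : ℕ, D ≤ d →
      EquivNet.IsEntrywiseUniversal G ((A.appendCopies M d).univClass σ) := by
  -- The extra `1` pays for the last layer: the relation must be stable one layer earlier, where the
  -- approximation starts.
  refine ⟨Module.finrank ℝ ((X → ℝ) × (X → ℝ)) + 1, fun d hd => ?_⟩
  obtain ⟨d, rfl⟩ := Nat.exists_eq_add_of_le' (Nat.one_le_of_lt hd)
  let N := fun d => (A.appendCopies M d).netSpace σ
  have hsep : ∀ x, EquivNet.entrySep (N d : Set C(Y₀ → ℝ, X → ℝ)) x =
      EquivNet.entrySep (N (d + 1) : Set C(Y₀ → ℝ, X → ℝ)) x := by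
    intro x
    ext p
    have hW := Submodule.eq_succ_of_recurrence
      (W := fun d => (N d).map (EquivNet.evalPair p).toLinearMap)
      (fun d => EquivNet.map_evalPair_le hσ hσ_poly hM
        ((A.appendCopies M d).const_orbitVector_mem_netSpace 1) p)
      (fun d => EquivNet.map_evalPair_layerStep hσ (N d) p) (Nat.le_of_succ_le_succ hd)
    rw [EquivNet.mem_entrySep_iff_map_evalPair, hW, ← EquivNet.mem_entrySep_iff_map_evalPair]
  rw [EquivNet.IsEntrywiseUniversal, EquivNet.LayerSeq.univClass_eq_closure_netSpace hσ]
  refine Set.Subset.antisymm (fun f hf => ⟨?_, fun x p hp => hp f hf⟩) fun f hf => ?_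
  · exact closure_minimal (fun u hu => EquivNet.LayerSeq.isEquivariant_of_mem_netSpace _ hu)
      (EquivNet.isClosed_setOf_isEquivariant G) hf
  · refine EquivNet.LayerSeq.mem_closure_layerStep_of_respecting hσ hσ_poly
      (A.appendCopies M d) hM ⟨hf.1, fun x p hp => hf.2 x p ?_⟩
    rw [EquivNet.entrySep_closure]
    exact (hsep x).le hp
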